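/- There is a universal constant $c>0$ with the following property. Let $n\in\mathbb{N}$ and let $L\ge 1$ be a real number with $6L\le n^{1/4}$. Let $S^{n-1}$ be the unit sphere of $\ell_2^n$, with the metric $\|x-y\|_{\ell_2^n}$. Then there is $\varepsilon>0$ such that every $\varepsilon$-net $\mathcal{N}$ of $S^{n-1}$ (that is, $\|a-b\|_{\ell_2^n}\ge\varepsilon$ for all distinct $a,b\in\mathcal{N}$, and for every $x\in S^{n-1}$ there is $a\in\mathcal{N}$ with $\|x-a\|_{\ell_2^n}\le\varepsilon$) is finite, and there are a Banach space $(Y,\|\cdot\|_Y)$, which can be taken to be the Wasserstein-1 space $W_1(\mathcal{N})$, and a $1$-Lipschitz mapping $f:\mathcal{N}\to Y$ such that $$\max_{a\in\mathcal{N}}\|F(a)-f(a)\|_Y\ \ge\ c\,\frac{\sqrt n}{L}\,\varepsilon$$ for every $L$-Lipschitz mapping $F:S^{n-1}\to Y$. Here $W_1(\mathcal{N})$ is the space of all $\mu:\mathcal{N}\to\mathbb{R}$ with $\sum_{a\in\mathcal{N}}\mu(a)=0$, equipped with the norm $\|\mu\|=\inf_\pi\sum_{a,b\in\mathcal{N}}\|a-b\|_{\ell_2^n}\,\pi(a,b)$,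 where the infimum is over all $\pi:\mathcal{N}\times\mathcal{N}\to[0,\infty)$ with $\sum_{b}\pi(a,b)=\max\{\mu(a),0\}$ and $\sum_{b}\pi(b,a)=\max\{-\mu(a),0\}$ for every $a\in\mathcal{N}$. -/

import Mathlib

open scoped NNReal

/-- An `ε`-net of a metric space: a subset that is `ε`-separated and `ε`-dense. -/
structure IsNet {M : Type*} [MetricSpace M] (ε : ℝ) (N : Set M) : Prop where
  separated : ∀ a ∈ N, ∀ b ∈ N, a ≠ b → ε ≤ dist a b
  dense : ∀ x : M, ∃ a ∈ N, dist x a ≤ ε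

/-- The vector space underlying the Wasserstein-1 space of a finite set `Ω`: the signed measures
`μ : Ω → ℝ` of vanishing total mass. -/
def WassersteinSpace (Ω : Type*) [Fintype Ω] : Submodule ℝ (Ω → ℝ) where
  carrier := {μ | ∑ ω, μ ω = 0}
  add_mem' := by
    intro μ ν hμ hν
    simp only [Set.mem_ofPred_eq] at hμ hν ⊢
    simp [Finset.sum_add_distrib, hμ, hν]
  zero_mem' := by simp
  smul_mem' := by
    intro c μ hμ
    simp only [Set.mem_ofPred_eq] at hμ ⊢
    simp [← Finset.mul_sum, hμ]

/-- `π` is a coupling of the (nonnegative) measures `α` and `β` on the finite set `Ω`: it is a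
nonnegative measure on `Ω × Ω` whose marginals are `α` and `β`. -/
structure IsCoupling {Ω : Type*} [Fintype Ω] (α β : Ω → ℝ) (π : Ω → Ω → ℝ) : Prop where
  nonneg : ∀ ω ω', 0 ≤ π ω ω'
  left : ∀ ω, ∑ ω', π ω ω' = α ω
  right : ∀ ω, ∑ ω', π ω' ω = β ω

/-- The Wasserstein-1 norm of `μ`: the infimal transportation cost over all the couplings of the
positive part and the negative part of `μ`. -/
noncomputable def wassersteinNorm {Ω : Type*} [Fintype Ω] [MetricSpace Ω] (μ : Ω → ℝ) : ℝ :=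
  sInf {t : ℝ | ∃ π : Ω → Ω → ℝ,
    IsCoupling (fun ω => max (μ ω) 0) (fun ω => max (-μ ω) 0) π ∧
      t = ∑ ω, ∑ ω', dist ω ω' * π ω ω'}

/-! Take `f a = δ_a - δ_o` and let `F` be `L`-Lipschitz with `‖F a - f a‖ ≤ τ` on the net. Test `F`
at the cube vertices `x_s = s / √n` against the coordinates scaled by `√n` and clipped to `[-1, 1]`.
The signed sum of all `n` clipped coordinates is `n`-Lipschitz and equals `n` at `x_s`, so closeness
to `f` makes its pairing with `F x_s`, plus its value at `o`, at least `n (1 - τ - (1 + L) ε)`.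
Averaged over `s`, the term of each coordinate becomes a discrete derivative of `F` along a cube
edge of length `2 / √n`. On an `ε`-separated set a clipped coordinate is `2 / ε`-Lipschitz, so this
average is at most `2 L / (ε √n)`. `one_le_of_lipschitz_approx` compares the two bounds; `ε = 4 L /
√n` then rules out `τ = 1/4`. -/

/-! ### The Wasserstein norm through flows. -/

section Flows

variable {Ω : Type*} [Fintype Ω]

/-- `π` is a nonnegative flow on `Ω × Ω` with divergence `μ`. -/
structure IsFlow (μ : Ω → ℝ) (π : Ω → Ω → ℝ) : Prop where
  nonneg : ∀ a b, 0 ≤ π a b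
  div : ∀ a, ∑ b, π a b - ∑ b, π b a = μ a

lemma IsCoupling.isFlow {μ : Ω → ℝ} {π : Ω → Ω → ℝ}
    (h : IsCoupling (fun a => max (μ a) 0) (fun a => max (-μ a) 0) π) : IsFlow μ π where
  nonneg := h.nonneg
  div a := by
    rw [h.left, h.right]
    rcases le_total (μ a) 0 with h0 | h0
    · rw [max_eq_right h0, max_eq_left (by linarith)]; ring
    · rw [max_eq_left h0, max_eq_right (by linarith)]; ring

lemma IsFlow.add {μ ν : Ω → ℝ} {π ρ : Ω → Ω → ℝ} (h : IsFlow μ π) (h' : IsFlow ν ρ) :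
    IsFlow (μ + ν) (π + ρ) where
  nonneg a b := add_nonneg (h.nonneg a b) (h'.nonneg a b)
  div a := by
    simp only [Pi.add_apply, Finset.sum_add_distrib, ← h.div, ← h'.div]
    ring

lemma IsFlow.smul {μ : Ω → ℝ} {π : Ω → Ω → ℝ} (h : IsFlow μ π) {c : ℝ} (hc : 0 ≤ c) :
    IsFlow (c • μ) (c • π) where
  nonneg a b := mul_nonneg hc (h.nonneg a b)
  div a := by
    simp only [Pi.smul_apply, smul_eq_mul, ← h.div, ← Finset.mul_sum]
    ring

lemma IsFlow.transpose {μ : Ω → ℝ} {π : Ω → Ω → ℝ} (h : IsFlow μ π) :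
    IsFlow (-μ) (fun a b => π b a) where
  nonneg a b := h.nonneg b a
  div a := by rw [Pi.neg_apply, ← h.div]; ring

/-- The net flow between `a` and `b` is `(μ a - μ b) / card Ω`; summed over `b` it leaves `μ a`,
since `μ` has total mass zero. -/
lemma exists_isFlow (μ : Ω → ℝ) (hμ : ∑ a, μ a = 0) : ∃ π, IsFlow μ π := by
  refine ⟨fun a b => max (μ a - μ b) 0 / Fintype.card Ω, fun a b => by positivity, fun a => ?_⟩
  have : Nonempty Ω := ⟨a⟩
  have hc : (Fintype.card Ω : ℝ) ≠ 0 := by exact_mod_cast Fintype.card_ne_zero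
  have key : ∀ b, max (μ a - μ b) 0 / Fintype.card Ω - max (μ b - μ a) 0 / Fintype.card Ω
      = (μ a - μ b) / Fintype.card Ω := by
    intro b
    rw [← sub_div]
    congr 1
    rcases le_total (μ a) (μ b) with h | h
    · rw [max_eq_right (by linarith), max_eq_left (by linarith)]; ring
    · rw [max_eq_left (by linarith), max_eq_right (by linarith)]; ring
  rw [← Finset.sum_sub_distrib, Finset.sum_congr rfl fun b _ => key b, ← Finset.sum_div,
    Finset.sum_sub_distrib, hμ]
  simp

/-- The unit flow from `u` to `v`. -/
def unitFlow [DecidableEq Ω] (u v : Ω) (a b : Ω) : ℝ :=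
  (if a = u then 1 else 0) * (if b = v then 1 else 0)

lemma sum_unitFlow_right [DecidableEq Ω] (u v a : Ω) :
    ∑ b, unitFlow u v a b = if a = u then 1 else 0 := by
  simp [unitFlow]

lemma sum_unitFlow_left [DecidableEq Ω] (u v b : Ω) :
    ∑ a, unitFlow u v a b = if b = v then 1 else 0 := by
  simp [unitFlow]

variable [MetricSpace Ω]

/-- The transportation cost of `π`. -/
def transportCost (π : Ω → Ω → ℝ) : ℝ := ∑ a, ∑ b, dist a b * π a b

lemma transportCost_nonneg {π : Ω → Ω → ℝ} (h : ∀ a b, 0 ≤ π a b) : 0 ≤ transportCost π :=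
  Finset.sum_nonneg fun a _ => Finset.sum_nonneg fun b _ => mul_nonneg dist_nonneg (h a b)

lemma transportCost_add (π ρ : Ω → Ω → ℝ) :
    transportCost (π + ρ) = transportCost π + transportCost ρ := by
  simp [transportCost, mul_add, Finset.sum_add_distrib]

lemma transportCost_smul (c : ℝ) (π : Ω → Ω → ℝ) :
    transportCost (c • π) = c * transportCost π := by
  simp only [transportCost, Finset.mul_sum, Pi.smul_apply, smul_eq_mul]
  exact Finset.sum_congr rfl fun a _ => Finset.sum_congr rfl fun b _ => by ring

lemma transportCost_transpose (π : Ω → Ω → ℝ) :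
    transportCost (fun a b => π b a) = transportCost π := by
  rw [transportCost, Finset.sum_comm, transportCost]
  simp only [dist_comm]

lemma transportCost_unitFlow [DecidableEq Ω] (u v : Ω) :
    transportCost (unitFlow u v) = dist u v := by
  simp [transportCost, unitFlow]

/-- A flow can be rerouted, without increasing the cost, so that no point both receives and sends
mass. -/
lemma IsFlow.exists_coupling {μ : Ω → ℝ} {π : Ω → Ω → ℝ} (hπ : IsFlow μ π) :
    ∃ ρ, IsCoupling (fun a => max (μ a) 0) (fun a => max (-μ a) 0) ρ ∧
      transportCost ρ ≤ transportCost π := by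
  classical
  set mass : (Ω → Ω → ℝ) → ℝ := fun ρ => ∑ a, ∑ b, ρ a b with hmass
  -- Cost ignores the diagonal, so it alone does not bound a flow; the mass constraint makes `S`
  -- compact, and mass is what gets minimized.
  set S : Set (Ω → Ω → ℝ) := {ρ | IsFlow μ ρ ∧ transportCost ρ ≤ transportCost π ∧
    mass ρ ≤ mass π} with hS
  have hcont : ∀ a b : Ω, Continuous fun ρ : Ω → Ω → ℝ => ρ a b := fun a b => by fun_prop
  have hmc : Continuous mass := by fun_prop
  have hcc : Continuous (transportCost : (Ω → Ω → ℝ) → ℝ) := by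
    unfold transportCost; fun_prop
  have hclosed : IsClosed S := by
    have h1 : IsClosed {ρ : Ω → Ω → ℝ | ∀ a b, 0 ≤ ρ a b} := by
      simp only [Set.ofPred_forall]
      exact isClosed_iInter fun a => isClosed_iInter fun b =>
        isClosed_le continuous_const (hcont a b)
    have h2 : IsClosed {ρ : Ω → Ω → ℝ | ∀ a, ∑ b, ρ a b - ∑ b, ρ b a = μ a} := by
      simp only [Set.ofPred_forall]
      exact isClosed_iInter fun a => isClosed_eq (by fun_prop) continuous_const
    have h3 := isClosed_le hcc (continuous_const (y := transportCost π))
    have h4 := isClosed_le hmc (continuous_const (y := mass π))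
    convert ((h1.inter h2).inter (h3.inter h4)) using 1
    ext ρ
    constructor
    · rintro ⟨⟨p, q⟩, r, s⟩
      exact ⟨⟨p, q⟩, r, s⟩
    · rintro ⟨⟨p, q⟩, r, s⟩
      exact ⟨⟨p, q⟩, r, s⟩
  have hsub : S ⊆ Set.Icc (fun _ _ => 0) (fun _ _ => mass π) := by
    rintro ρ ⟨hρ, -, hm⟩
    refine ⟨fun a b => hρ.nonneg a b, fun a b => le_trans ?_ hm⟩
    exact (Finset.single_le_sum (f := fun b => ρ a b) (fun b _ => hρ.nonneg a b)
      (Finset.mem_univ b)).trans (Finset.single_le_sum (f := fun a => ∑ b, ρ a b)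
        (fun a _ => Finset.sum_nonneg fun b _ => hρ.nonneg a b) (Finset.mem_univ a))
  have hcomp : IsCompact S := isCompact_Icc.of_isClosed_subset hclosed hsub
  obtain ⟨ρ, ⟨hρ, hρc, hρm⟩, hmin⟩ :=
    hcomp.exists_isMinOn ⟨π, hπ, le_rfl, le_rfl⟩ hmc.continuousOn
  have hex : ∀ a b c, ρ b a = 0 ∨ ρ a c = 0 := by
    intro a b c
    by_contra! hcon
    have hba : 0 < ρ b a := lt_of_le_of_ne (hρ.nonneg b a) hcon.1.symm
    have hac : 0 < ρ a c := lt_of_le_of_ne (hρ.nonneg a c) hcon.2.symm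
    obtain ⟨t, ht0, htba, htac⟩ : ∃ t : ℝ, 0 < t ∧ t ≤ ρ b a ∧ t ≤ ρ a c :=
      ⟨min (ρ b a) (ρ a c), lt_min hba hac, min_le_left _ _, min_le_right _ _⟩
    -- Replace `t` units of the route `b → a → c` by the direct `b → c`: divergence is kept, cost
    -- does not rise, and mass drops by `t`, against minimality.
    set ρ' : Ω → Ω → ℝ :=
      ρ + t • unitFlow b c + (-t) • unitFlow b a + (-t) • unitFlow a c with hρ'
    have hcost : transportCost ρ' =
        transportCost ρ + t * dist b c + (-t) * dist b a + (-t) * dist a c := by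
      simp only [hρ', transportCost_add, transportCost_smul, transportCost_unitFlow]
    have hm : mass ρ' = mass ρ - t := by
      simp only [hmass, hρ', Pi.add_apply, Pi.smul_apply, smul_eq_mul, Finset.sum_add_distrib,
        ← Finset.mul_sum, sum_unitFlow_right, Finset.sum_ite_eq', Finset.mem_univ, if_true]
      ring
    have hflow : IsFlow μ ρ' := by
      constructor
      · intro u v
        have h0 := hρ.nonneg u v
        simp only [hρ', Pi.add_apply, Pi.smul_apply, smul_eq_mul, unitFlow]
        split_ifs <;> subst_vars <;> linarith
      · intro u
        simp only [hρ', Pi.add_apply, Pi.smul_apply, smul_eq_mul, Finset.sum_add_distrib,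
          ← Finset.mul_sum, sum_unitFlow_right, sum_unitFlow_left, ← hρ.div]
        ring
    have htri := mul_le_mul_of_nonneg_left (dist_triangle b a c) ht0.le
    have := hmin (show ρ' ∈ S from ⟨hflow, by rw [hcost]; linarith, by rw [hm]; linarith⟩)
    simp only [Set.mem_ofPred_eq] at this
    linarith
  have hzero : ∀ a, ∑ b, ρ a b = 0 ∨ ∑ b, ρ b a = 0 := by
    intro a
    by_contra! hcon
    obtain ⟨c, -, hc⟩ := Finset.exists_ne_zero_of_sum_ne_zero hcon.1
    obtain ⟨b, -, hb⟩ := Finset.exists_ne_zero_of_sum_ne_zero hcon.2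
    exact (hex a b c).elim hb hc
  have hout : ∀ a, 0 ≤ ∑ b, ρ a b := fun a => Finset.sum_nonneg fun b _ => hρ.nonneg a b
  have hin : ∀ a, 0 ≤ ∑ b, ρ b a := fun a => Finset.sum_nonneg fun b _ => hρ.nonneg b a
  refine ⟨ρ, ⟨hρ.nonneg, fun a => ?_, fun a => ?_⟩, hρc⟩ <;>
  · have h1 := hρ.div a
    have h2 := hout a
    have h3 := hin a
    rcases hzero a with h | h <;>
      first
      | rw [max_eq_left (by linarith)]; linarith
      | rw [max_eq_right (by linarith)]; linarith

lemma bddBelow_couplingCosts (μ : Ω → ℝ) : BddBelow {t : ℝ | ∃ π : Ω → Ω → ℝ,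
    IsCoupling (fun ω => max (μ ω) 0) (fun ω => max (-μ ω) 0) π ∧
      t = ∑ ω, ∑ ω', dist ω ω' * π ω ω'} :=
  ⟨0, by rintro _ ⟨π, hπ, rfl⟩; exact transportCost_nonneg hπ.nonneg⟩

lemma IsFlow.wassersteinNorm_le {μ : Ω → ℝ} {π : Ω → Ω → ℝ} (h : IsFlow μ π) :
    wassersteinNorm μ ≤ transportCost π := by
  obtain ⟨ρ, hρ, hc⟩ := h.exists_coupling
  exact (csInf_le (bddBelow_couplingCosts μ) ⟨ρ, hρ, rfl⟩).trans hc

/-- Flows add and scale with `μ`, unlike its positive and negative parts, so the norm axioms are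
checked on flows. -/
lemma le_wassersteinNorm {μ : Ω → ℝ} (hμ : ∑ a, μ a = 0) {t : ℝ}
    (h : ∀ π, IsFlow μ π → t ≤ transportCost π) : t ≤ wassersteinNorm μ := by
  obtain ⟨π, hπ⟩ := exists_isFlow μ hμ
  obtain ⟨ρ, hρ, -⟩ := hπ.exists_coupling
  refine le_csInf ⟨_, ρ, hρ, rfl⟩ ?_
  rintro _ ⟨σ, hσ, rfl⟩
  exact h σ hσ.isFlow

lemma wassersteinNorm_nonneg (μ : Ω → ℝ) : 0 ≤ wassersteinNorm μ :=
  Real.sInf_nonneg (by rintro _ ⟨π, hπ, rfl⟩; exact transportCost_nonneg hπ.nonneg)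

lemma wassersteinNorm_add_le {μ ν : Ω → ℝ} (hμ : ∑ a, μ a = 0) (hν : ∑ a, ν a = 0) :
    wassersteinNorm (μ + ν) ≤ wassersteinNorm μ + wassersteinNorm ν := by
  rw [← sub_le_iff_le_add]
  refine le_wassersteinNorm hμ fun π hπ => ?_
  rw [sub_le_comm]
  refine le_wassersteinNorm hν fun ρ hρ => ?_
  rw [sub_le_iff_le_add', ← transportCost_add]
  exact (hπ.add hρ).wassersteinNorm_le

lemma wassersteinNorm_neg_le {μ : Ω → ℝ} (hμ : ∑ a, μ a = 0) :
    wassersteinNorm (-μ) ≤ wassersteinNorm μ :=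
  le_wassersteinNorm hμ fun π hπ =>
    hπ.transpose.wassersteinNorm_le.trans_eq (transportCost_transpose π)

lemma wassersteinNorm_smul_le_of_nonneg {μ : Ω → ℝ} (hμ : ∑ a, μ a = 0) {c : ℝ} (hc : 0 ≤ c) :
    wassersteinNorm (c • μ) ≤ c * wassersteinNorm μ := by
  rcases hc.eq_or_lt with rfl | hc'
  · obtain ⟨π, hπ⟩ := exists_isFlow μ hμ
    refine (hπ.smul le_rfl).wassersteinNorm_le.trans_eq ?_
    rw [transportCost_smul, zero_mul, zero_mul]
  · rw [← div_le_iff₀' hc']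
    refine le_wassersteinNorm hμ fun π hπ => ?_
    rw [div_le_iff₀' hc', ← transportCost_smul]
    exact (hπ.smul hc).wassersteinNorm_le

lemma wassersteinNorm_smul_le {μ : Ω → ℝ} (hμ : ∑ a, μ a = 0) (c : ℝ) :
    wassersteinNorm (c • μ) ≤ |c| * wassersteinNorm μ := by
  rcases le_total 0 c with hc | hc
  · rw [abs_of_nonneg hc]
    exact wassersteinNorm_smul_le_of_nonneg hμ hc
  · have hneg : ∑ a, (-μ) a = 0 := by simp [hμ]
    rw [abs_of_nonpos hc, ← neg_smul_neg]
    exact (wassersteinNorm_smul_le_of_nonneg hneg (neg_nonneg.2 hc)).trans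
      (mul_le_mul_of_nonneg_left (wassersteinNorm_neg_le hμ) (neg_nonneg.2 hc))

/-- The easy direction of Kantorovich duality. -/
lemma abs_sum_mul_le_wassersteinNorm {μ g : Ω → ℝ} (hμ : ∑ a, μ a = 0) {K : ℝ} (hK : 0 ≤ K)
    (hg : ∀ a b, |g a - g b| ≤ K * dist a b) :
    |∑ a, μ a * g a| ≤ K * wassersteinNorm μ := by
  have key : ∀ π, IsFlow μ π → |∑ a, μ a * g a| ≤ K * transportCost π := by
    intro π hπ
    have h1 : ∑ a, μ a * g a = ∑ a, ∑ b, π a b * (g a - g b) := by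
      simp only [mul_sub, Finset.sum_sub_distrib]
      rw [Finset.sum_comm (f := fun a b => π a b * g b), ← Finset.sum_sub_distrib]
      exact Finset.sum_congr rfl fun a _ => by
        rw [← Finset.sum_mul, ← Finset.sum_mul, ← sub_mul, hπ.div]
    rw [h1, transportCost, Finset.mul_sum]
    refine (Finset.abs_sum_le_sum_abs _ _).trans (Finset.sum_le_sum fun a _ => ?_)
    rw [Finset.mul_sum]
    refine (Finset.abs_sum_le_sum_abs _ _).trans (Finset.sum_le_sum fun b _ => ?_)
    rw [abs_mul, abs_of_nonneg (hπ.nonneg a b)]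
    exact (mul_le_mul_of_nonneg_left (hg a b) (hπ.nonneg a b)).trans_eq (by ring)
  rcases hK.eq_or_lt with rfl | hK'
  · obtain ⟨π, hπ⟩ := exists_isFlow μ hμ
    simpa using key π hπ
  · rw [← div_le_iff₀' hK']
    exact le_wassersteinNorm hμ fun π hπ => (div_le_iff₀' hK').2 (key π hπ)

lemma exists_lipschitz_const (g : Ω → ℝ) : ∃ K, 0 ≤ K ∧ ∀ a b, |g a - g b| ≤ K * dist a b := by
  have h0 : ∀ a b, 0 ≤ |g a - g b| / dist a b := fun a b => by positivity
  refine ⟨∑ a, ∑ b, |g a - g b| / dist a b,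
    Finset.sum_nonneg fun a _ => Finset.sum_nonneg fun b _ => h0 a b, fun a b => ?_⟩
  rcases eq_or_ne a b with rfl | hab
  · simp
  · rw [← div_le_iff₀ (dist_pos.2 hab)]
    exact (Finset.single_le_sum (f := fun b => |g a - g b| / dist a b) (fun b _ => h0 a b)
      (Finset.mem_univ b)).trans (Finset.single_le_sum
        (f := fun a => ∑ b, |g a - g b| / dist a b)
        (fun a _ => Finset.sum_nonneg fun b _ => h0 a b) (Finset.mem_univ a))

/-- The indicator of a point is Lipschitz on a finite space, so duality recovers each value of `μ`.
-/
lemma eq_zero_of_wassersteinNorm_eq_zero {μ : Ω → ℝ} (hμ : ∑ a, μ a = 0)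
    (h : wassersteinNorm μ = 0) : μ = 0 := by
  classical
  ext a
  obtain ⟨K, hK, hg⟩ := exists_lipschitz_const (fun b : Ω => if b = a then (1 : ℝ) else 0)
  have := abs_sum_mul_le_wassersteinNorm hμ hK hg
  simpa [h] using this

lemma wassersteinNorm_smul {μ : Ω → ℝ} (hμ : ∑ a, μ a = 0) (c : ℝ) :
    wassersteinNorm (c • μ) = |c| * wassersteinNorm μ := by
  refine le_antisymm (wassersteinNorm_smul_le hμ c) ?_
  rcases eq_or_ne c 0 with rfl | hc
  · simpa using wassersteinNorm_nonneg _
  · have hcμ : ∑ a, (c • μ) a = 0 := by simp [← Finset.mul_sum, hμ]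
    have h := wassersteinNorm_smul_le hcμ c⁻¹
    rw [inv_smul_smul₀ hc, abs_inv] at h
    rwa [← le_inv_mul_iff₀ (abs_pos.2 hc)]

end Flows

/-! ### The Banach space `W1`, kept apart from the submodule and its inherited sup norm. -/

/-- The space of signed measures of vanishing total mass, to be normed by `wassersteinNorm`. -/
def W1 (Ω : Type*) [Fintype Ω] : Type _ := WassersteinSpace Ω

namespace W1

variable {Ω : Type*} [Fintype Ω]

instance : AddCommGroup (W1 Ω) := inferInstanceAs (AddCommGroup (WassersteinSpace Ω))

noncomputable instance : Module ℝ (W1 Ω) := inferInstanceAs (Module ℝ (WassersteinSpace Ω))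

instance : FiniteDimensional ℝ (W1 Ω) :=
  inferInstanceAs (FiniteDimensional ℝ (WassersteinSpace Ω))

/-- The identification of `W1 Ω` with the underlying vector space. -/
noncomputable def toSpace : W1 Ω ≃ₗ[ℝ] WassersteinSpace Ω := LinearEquiv.refl ℝ (WassersteinSpace Ω)

lemma sum_eq_zero (y : W1 Ω) : ∑ a, (toSpace y : Ω → ℝ) a = 0 := (toSpace y).2

/-- Integration of `g` against a signed measure. -/
noncomputable def pairing (g : Ω → ℝ) : W1 Ω →ₗ[ℝ] ℝ where
  toFun y := ∑ a, (toSpace y : Ω → ℝ) a * g a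
  map_add' y z := by simp [add_mul, Finset.sum_add_distrib]
  map_smul' c y := by simp [Finset.mul_sum, mul_assoc]

lemma pairing_sum {ι : Type*} (s : Finset ι) (c : ι → ℝ) (g : ι → Ω → ℝ) (y : W1 Ω) :
    pairing (fun a => ∑ i ∈ s, c i * g i a) y = ∑ i ∈ s, c i * pairing (g i) y := by
  simp only [pairing, LinearMap.coe_mk, AddHom.coe_mk, Finset.mul_sum]
  rw [Finset.sum_comm]
  exact Finset.sum_congr rfl fun i _ => Finset.sum_congr rfl fun a _ => by ring

/-- The signed measure `δ_a - δ_b`. -/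
noncomputable def molecule [DecidableEq Ω] (a b : Ω) : W1 Ω :=
  toSpace.symm ⟨Pi.single a 1 - Pi.single b 1, by
    change ∑ ω, (Pi.single a 1 - Pi.single b 1 : Ω → ℝ) ω = 0
    simp [Finset.sum_sub_distrib]⟩

lemma toSpace_molecule [DecidableEq Ω] (a b : Ω) :
    (toSpace (molecule a b) : Ω → ℝ) = Pi.single a 1 - Pi.single b 1 := by
  rw [molecule, LinearEquiv.apply_symm_apply]

lemma pairing_molecule [DecidableEq Ω] (g : Ω → ℝ) (a b : Ω) :
    pairing g (molecule a b) = g a - g b := by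
  simp [pairing, toSpace_molecule, sub_mul, Finset.sum_sub_distrib, Pi.single_apply]

lemma molecule_sub_molecule [DecidableEq Ω] (a b c : Ω) :
    molecule a c - molecule b c = molecule a b := by
  refine toSpace.injective (Subtype.ext ?_)
  rw [map_sub, Submodule.coe_sub]
  simp only [toSpace_molecule]
  abel

variable [MetricSpace Ω]

noncomputable instance : Norm (W1 Ω) := ⟨fun y => wassersteinNorm (toSpace y : Ω → ℝ)⟩

lemma norm_def (y : W1 Ω) : ‖y‖ = wassersteinNorm (toSpace y : Ω → ℝ) := rfl

lemma normedSpaceCore : NormedSpace.Core ℝ (W1 Ω) where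
  norm_nonneg y := wassersteinNorm_nonneg _
  norm_smul c y := by
    rw [norm_def, map_smul, Submodule.coe_smul, wassersteinNorm_smul y.sum_eq_zero]
    rfl
  norm_triangle y z := by
    simp only [norm_def, map_add, Submodule.coe_add]
    exact wassersteinNorm_add_le y.sum_eq_zero z.sum_eq_zero
  norm_eq_zero_iff y := by
    constructor
    · intro h
      have := eq_zero_of_wassersteinNorm_eq_zero y.sum_eq_zero h
      exact toSpace.map_eq_zero_iff.1 (Subtype.ext this)
    · rintro rfl
      have := wassersteinNorm_smul (Ω := Ω) (μ := 0) (by simp) 0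
      simpa [norm_def] using this

noncomputable instance : NormedAddCommGroup (W1 Ω) := NormedAddCommGroup.ofCore normedSpaceCore

noncomputable instance : NormedSpace ℝ (W1 Ω) := NormedSpace.ofCore normedSpaceCore

instance : CompleteSpace (W1 Ω) := FiniteDimensional.complete ℝ (W1 Ω)

lemma abs_pairing_le {g : Ω → ℝ} {K : ℝ} (hK : 0 ≤ K) (hg : ∀ a b, |g a - g b| ≤ K * dist a b)
    (y : W1 Ω) : |pairing g y| ≤ K * ‖y‖ :=
  abs_sum_mul_le_wassersteinNorm y.sum_eq_zero hK hg

lemma norm_molecule_le [DecidableEq Ω] (a b : Ω) : ‖molecule a b‖ ≤ dist a b := by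
  rw [norm_def, toSpace_molecule, ← transportCost_unitFlow a b]
  refine IsFlow.wassersteinNorm_le ⟨fun u v => ?_, fun u => ?_⟩
  · unfold unitFlow; positivity
  · rw [sum_unitFlow_right, sum_unitFlow_left]
    simp [Pi.single_apply]

/-- This is the map `f` of the theorem. -/
lemma lipschitzWith_molecule [DecidableEq Ω] (c : Ω) :
    LipschitzWith 1 fun a : Ω => molecule a c :=
  LipschitzWith.of_dist_le_mul fun a b => by
    rw [dist_eq_norm, molecule_sub_molecule, NNReal.coe_one, one_mul]
    exact norm_molecule_le a b

end W1

/-! ### Finiteness of nets, by covering with balls of radius `ε / 2`. -/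

lemma IsNet.finite {M : Type*} [MetricSpace M] [CompactSpace M] {ε : ℝ} (hε : 0 < ε) {N : Set M}
    (hN : IsNet ε N) : N.Finite := by
  obtain ⟨t, ht, hcover⟩ := Metric.totallyBounded_iff.1
    (isCompact_univ (X := M)).totallyBounded (ε / 2) (half_pos hε)
  have hchoose : ∀ x : M, ∃ y ∈ t, dist x y < ε / 2 := fun x => by
    simpa using hcover (Set.mem_univ x)
  choose p hpt hp using hchoose
  refine Set.Finite.of_finite_image (f := p) (ht.subset ?_) fun a ha b hb hab => ?_
  · rintro _ ⟨a, -, rfl⟩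
    exact hpt a
  · by_contra hne
    have h1 := hN.separated a ha b hb hne
    have h2 := dist_triangle_right a b (p a)
    have h3 := hp a
    have h4 := hp b
    rw [← hab] at h4
    linarith

/-! ### The inscribed cube and clipped coordinates. -/

section Cube

/-- The real sign of a Boolean. -/
def boolSign (b : Bool) : ℝ := if b then 1 else -1

lemma boolSign_not (b : Bool) : boolSign (!b) = -boolSign b := by cases b <;> simp [boolSign]

lemma abs_boolSign (b : Bool) : |boolSign b| = 1 := by cases b <;> simp [boolSign]

lemma boolSign_mul_self (b : Bool) : boolSign b * boolSign b = 1 := by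
  cases b <;> simp [boolSign]

variable {ι : Type*} [DecidableEq ι]

/-- Flip the `i`-th coordinate of a point of the discrete cube. -/
def cubeFlip (i : ι) (s : ι → Bool) : ι → Bool := Function.update s i (!s i)

lemma cubeFlip_involutive (i : ι) : Function.Involutive (cubeFlip i) := fun s => by
  simp [cubeFlip]

/-- Flipping coordinate `i` permutes the cube and reverses the sign; averaging the two forms of the
sum gives a discrete derivative. -/
lemma sum_boolSign_mul [Fintype ι] (i : ι) (H : (ι → Bool) → ℝ) :
    ∑ s, boolSign (s i) * H s = ∑ s, boolSign (s i) * (H s - H (cubeFlip i s)) / 2 := by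
  have h : ∑ s, boolSign (s i) * H s = ∑ s, -(boolSign (s i) * H (cubeFlip i s)) := by
    rw [← Equiv.sum_comp (cubeFlip_involutive i).toPerm]
    refine Finset.sum_congr rfl fun s _ => ?_
    simp [cubeFlip, boolSign_not]
  have h2 : ∑ s, boolSign (s i) * (H s - H (cubeFlip i s)) / 2 =
      (∑ s, boolSign (s i) * H s + ∑ s, -(boolSign (s i) * H (cubeFlip i s))) / 2 := by
    rw [← Finset.sum_add_distrib, Finset.sum_div]
    exact Finset.sum_congr rfl fun s _ => by ring
  rw [h2, ← h]
  ring

lemma sum_boolSign_mul_le [Fintype ι] (i : ι) {H : (ι → Bool) → ℝ} {C : ℝ}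
    (hH : ∀ s, |H s - H (cubeFlip i s)| ≤ C) :
    ∑ s, boolSign (s i) * H s ≤ Fintype.card (ι → Bool) * (C / 2) := by
  rw [sum_boolSign_mul, ← nsmul_eq_mul, ← Finset.card_univ]
  refine Finset.sum_le_card_nsmul _ _ _ fun s _ => ?_
  have h := le_abs_self (boolSign (s i) * (H s - H (cubeFlip i s)))
  rw [abs_mul, abs_boolSign, one_mul] at h
  linarith [hH s]

variable {n : ℕ}

/-- The vertex `n^{-1/2} s` of the cube inscribed in the unit sphere. -/
noncomputable def cubeVertex (hn : 0 < n) (s : Fin n → Bool) :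
    Metric.sphere (0 : EuclideanSpace ℝ (Fin n)) 1 :=
  ⟨WithLp.toLp 2 fun i => boolSign (s i) / √n, by
    have : (n : ℝ) ≠ 0 := by positivity
    simp [EuclideanSpace.norm_eq, abs_boolSign, this]⟩

lemma cubeVertex_apply (hn : 0 < n) (s : Fin n → Bool) (i : Fin n) :
    (cubeVertex hn s : EuclideanSpace ℝ (Fin n)) i = boolSign (s i) / √n := rfl

lemma dist_cubeVertex_cubeFlip (hn : 0 < n) (s : Fin n → Bool) (i : Fin n) :
    dist (cubeVertex hn s) (cubeVertex hn (cubeFlip i s)) ≤ 2 / √n := by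
  rw [Subtype.dist_eq, EuclideanSpace.dist_eq, Finset.sum_eq_single i]
  · rw [Real.sqrt_sq dist_nonneg, cubeVertex_apply, cubeVertex_apply, Real.dist_eq]
    have h : boolSign (s i) / √n - boolSign (cubeFlip i s i) / √n
        = 2 * boolSign (s i) / √n := by
      simp [cubeFlip, boolSign_not]; ring
    rw [h, abs_div, abs_mul, abs_boolSign, abs_of_nonneg (Real.sqrt_nonneg _)]
    simp
  · intro j _ hj
    simp [cubeVertex_apply, cubeFlip, Function.update_of_ne hj]
  · simp

lemma sum_abs_sub_le (x y : EuclideanSpace ℝ (Fin n)) :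
    ∑ i, |x i - y i| ≤ √n * dist x y := by
  have h := Real.sum_mul_le_sqrt_mul_sqrt Finset.univ (fun _ : Fin n => (1 : ℝ))
    (fun i => |x i - y i|)
  simpa [EuclideanSpace.dist_eq, Real.dist_eq] using h

/-- The `i`-th coordinate scaled by `√n`, truncated to `[-1, 1]`. -/
noncomputable def clipCoord (i : Fin n) (x : Metric.sphere (0 : EuclideanSpace ℝ (Fin n)) 1) : ℝ :=
  max (-1) (min 1 (√n * (x : EuclideanSpace ℝ (Fin n)) i))

lemma abs_clipCoord_sub_le (i : Fin n) (x y : Metric.sphere (0 : EuclideanSpace ℝ (Fin n)) 1) :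
    |clipCoord i x - clipCoord i y| ≤ √n * |x.1 i - y.1 i| := by
  unfold clipCoord
  rw [max_comm, max_comm (-1) (min 1 (√n * y.1 i))]
  refine (abs_max_sub_max_le_abs _ _ _).trans ?_
  rw [min_comm, min_comm 1 (√n * y.1 i)]
  refine (abs_min_sub_min_le_max _ _ _ _).trans ?_
  rw [sub_self, abs_zero, max_eq_left (abs_nonneg _), ← mul_sub, abs_mul,
    abs_of_nonneg (Real.sqrt_nonneg _)]

/-- The purpose of clipping: bounded oscillation and `ε`-separation give the Lipschitz constant `2 /
ε` on the net. -/
lemma abs_clipCoord_sub_le_two (i : Fin n)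
    (x y : Metric.sphere (0 : EuclideanSpace ℝ (Fin n)) 1) :
    |clipCoord i x - clipCoord i y| ≤ 2 := by
  have h : ∀ z, -1 ≤ clipCoord i z ∧ clipCoord i z ≤ 1 := fun z =>
    ⟨le_max_left _ _, max_le (by norm_num) (min_le_left _ _)⟩
  rw [abs_le]
  constructor <;> linarith [(h x).1, (h x).2, (h y).1, (h y).2]

lemma clipCoord_cubeVertex (hn : 0 < n) (s : Fin n → Bool) (i : Fin n) :
    clipCoord i (cubeVertex hn s) = boolSign (s i) := by
  have : √(n : ℝ) ≠ 0 := by positivity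
  rw [clipCoord, cubeVertex_apply, mul_div_cancel₀ _ this]
  cases s i <;> simp [boolSign]

/-- The `n`-Lipschitz function `∑ i, s i * clipCoord i`, which peaks at `cubeVertex hn s`. -/
lemma abs_sum_boolSign_mul_clipCoord_sub_le (s : Fin n → Bool)
    (x y : Metric.sphere (0 : EuclideanSpace ℝ (Fin n)) 1) :
    |∑ i, boolSign (s i) * clipCoord i x - ∑ i, boolSign (s i) * clipCoord i y|
      ≤ n * dist x y := by
  rw [← Finset.sum_sub_distrib]
  calc |∑ i, (boolSign (s i) * clipCoord i x - boolSign (s i) * clipCoord i y)|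
      ≤ ∑ i, √n * |x.1 i - y.1 i| := by
        refine (Finset.abs_sum_le_sum_abs _ _).trans (Finset.sum_le_sum fun i _ => ?_)
        rw [← mul_sub, abs_mul, abs_boolSign, one_mul]
        exact abs_clipCoord_sub_le i x y
    _ ≤ √n * (√n * dist x y) := by
        rw [← Finset.mul_sum]
        exact mul_le_mul_of_nonneg_left (sum_abs_sub_le _ _) (Real.sqrt_nonneg _)
    _ = n * dist x y := by rw [← mul_assoc, Real.mul_self_sqrt (Nat.cast_nonneg n)]

end Cube

/-! ### The averaging argument and the choice of constants. -/

open W1 in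
/-- A Lipschitz map from the sphere to `W1 N` that is uniformly close to `a ↦ δ_a - δ_o` on an
`ε`-net `N` satisfies a quantitative constraint coming from the inscribed cube. -/
lemma one_le_of_lipschitz_approx {n : ℕ} (hn : 0 < n) {ε τ : ℝ} (hε : 0 < ε)
    {N : Set (Metric.sphere (0 : EuclideanSpace ℝ (Fin n)) 1)} (hN : IsNet ε N) [Fintype N]
    [DecidableEq N] (o : N) {L : ℝ≥0}
    {F : Metric.sphere (0 : EuclideanSpace ℝ (Fin n)) 1 → W1 N} (hF : LipschitzWith L F)
    (hτ : ∀ a : N, ‖F a - molecule a o‖ ≤ τ) :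
    1 ≤ τ + (1 + L) * ε + 2 * L / (ε * √n) := by
  have hn' : (0 : ℝ) < n := by exact_mod_cast hn
  set b : Fin n → N → ℝ := fun i a => clipCoord i a with hb
  have hlow : ∀ s : Fin n → Bool, n * (1 - τ - (1 + L) * ε) ≤
      ∑ i, boolSign (s i) * (pairing (b i) (F (cubeVertex hn s)) + b i o) := by
    intro s
    obtain ⟨a, haN, hxa⟩ := hN.dense (cubeVertex hn s)
    set G : N → ℝ := fun c => ∑ i, boolSign (s i) * b i c with hG
    have hGL : ∀ c d, |G c - G d| ≤ n * dist c d := fun c d =>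
      abs_sum_boolSign_mul_clipCoord_sub_le s c d
    -- Pass from `F x_s` to `F a` at cost `L ε`, then to `f a` at cost `τ`.
    have h1 : |pairing G (F (cubeVertex hn s) - molecule ⟨a, haN⟩ o)| ≤ n * (L * ε + τ) := by
      refine (abs_pairing_le hn'.le hGL _).trans (mul_le_mul_of_nonneg_left ?_ hn'.le)
      refine (norm_sub_le_norm_sub_add_norm_sub _ (F a) _).trans (add_le_add ?_ (hτ ⟨a, haN⟩))
      rw [← dist_eq_norm]
      exact (hF.dist_le_mul _ _).trans (mul_le_mul_of_nonneg_left hxa L.2)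
    have h2 := abs_sum_boolSign_mul_clipCoord_sub_le s (cubeVertex hn s) a
    simp only [clipCoord_cubeVertex, boolSign_mul_self, Finset.sum_const, Finset.card_univ,
      Fintype.card_fin, nsmul_eq_mul, mul_one] at h2
    have h3 := mul_le_mul_of_nonneg_left hxa hn'.le
    have h4 : ∑ i, boolSign (s i) * (pairing (b i) (F (cubeVertex hn s)) + b i o) =
        pairing G (F (cubeVertex hn s)) + G o := by
      simp only [mul_add, Finset.sum_add_distrib, hG, pairing_sum]
    rw [h4]
    rw [map_sub, pairing_molecule] at h1
    have h5 : G ⟨a, haN⟩ = ∑ i, boolSign (s i) * clipCoord i a := rfl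
    rw [h5] at h1
    have := (abs_le.1 h1).1
    have := (abs_le.1 h2).2
    linarith
  have hup : ∀ i, ∑ s : Fin n → Bool,
      boolSign (s i) * (pairing (b i) (F (cubeVertex hn s)) + b i o) ≤
        Fintype.card (Fin n → Bool) * ((2 / ε * (L * (2 / √n))) / 2) := by
    intro i
    refine sum_boolSign_mul_le i fun s => ?_
    -- The base point term `b i o` does not depend on `s`, so it cancels in the difference.
    rw [add_sub_add_right_eq_sub, ← map_sub]
    have hbL : ∀ c d, |b i c - b i d| ≤ 2 / ε * dist c d := by
      intro c d
      rcases eq_or_ne c d with rfl | hcd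
      · simp
      · have h := hN.separated c c.2 d d.2 fun h => hcd (Subtype.ext h)
        have h' : 1 ≤ dist c d / ε := (one_le_div hε).2 h
        calc |b i c - b i d| ≤ 2 := abs_clipCoord_sub_le_two i c d
          _ ≤ 2 * (dist c d / ε) := by linarith
          _ = 2 / ε * dist c d := by ring
    refine (abs_pairing_le (by positivity) hbL _).trans
      (mul_le_mul_of_nonneg_left ?_ (by positivity))
    rw [← dist_eq_norm]
    exact (hF.dist_le_mul _ _).trans
      (mul_le_mul_of_nonneg_left (dist_cubeVertex_cubeFlip hn s i) L.2)
  have hcard : (0 : ℝ) < Fintype.card (Fin n → Bool) := by exact_mod_cast Fintype.card_pos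
  have hsum : Fintype.card (Fin n → Bool) * (n * (1 - τ - (1 + L) * ε)) ≤
      n * (Fintype.card (Fin n → Bool) * ((2 / ε * (L * (2 / √n))) / 2)) := by
    calc _ = ∑ _s : Fin n → Bool, n * (1 - τ - (1 + L) * ε) := by
          simp only [Finset.sum_const, Finset.card_univ, nsmul_eq_mul]
      _ ≤ ∑ s : Fin n → Bool, ∑ i,
          boolSign (s i) * (pairing (b i) (F (cubeVertex hn s)) + b i o) :=
          Finset.sum_le_sum fun s _ => hlow s
      _ = ∑ i, ∑ s : Fin n → Bool,
          boolSign (s i) * (pairing (b i) (F (cubeVertex hn s)) + b i o) := Finset.sum_comm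
      _ ≤ ∑ _i : Fin n, (Fintype.card (Fin n → Bool) * ((2 / ε * (L * (2 / √n))) / 2)) :=
          Finset.sum_le_sum fun i _ => hup i
      _ = _ := by simp only [Finset.sum_const, Finset.card_univ, Fintype.card_fin, nsmul_eq_mul]
  rw [mul_left_comm] at hsum
  have h := le_of_mul_le_mul_left (le_of_mul_le_mul_left hsum hn') hcard
  have h' : 2 / ε * (L * (2 / √(n : ℝ))) / 2 = 2 * L / (ε * √n) := by
    field_simp
  rw [h'] at h
  linarith

theorem theorem4 :
    ∃ c : ℝ, 0 < c ∧ ∀ (n : ℕ) (L : ℝ≥0), 1 ≤ L → 6 * (L : ℝ) ≤ (n : ℝ) ^ (1 / 4 : ℝ) →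
      ∃ ε : ℝ, 0 < ε ∧
        ∀ N : Set (Metric.sphere (0 : EuclideanSpace ℝ (Fin n)) 1), IsNet ε N →
          -- the net is finite, and there is a Banach space `Y`
          ∃ (_ : Fintype N) (Y : Type) (_ : NormedAddCommGroup Y) (_ : NormedSpace ℝ Y)
            (_ : CompleteSpace Y),
            -- which is the Wasserstein-1 space of the net
            (∃ e : Y ≃ₗ[ℝ] WassersteinSpace N,
              ∀ y : Y, ‖y‖ = wassersteinNorm (e y : N → ℝ)) ∧
            ∃ f : N → Y, LipschitzWith 1 f ∧
              ∀ F : Metric.sphere (0 : EuclideanSpace ℝ (Fin n)) 1 → Y, LipschitzWith L F →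
                ∃ a : N, c * (Real.sqrt n / L) * ε ≤ ‖F a - f a‖ := by
  refine ⟨1 / 16, by norm_num, fun n L hL hLn => ?_⟩
  have hL' : (1 : ℝ) ≤ L := by exact_mod_cast hL
  have hn : 0 < n := by
    rcases Nat.eq_zero_or_pos n with rfl | h
    · norm_num at hLn
      linarith
    · exact h
  have hsqrt : 36 * (L : ℝ) ^ 2 ≤ √n := by
    have h := pow_le_pow_left₀ (by positivity) hLn 2
    rw [← Real.rpow_natCast, ← Real.rpow_natCast, ← Real.rpow_mul (Nat.cast_nonneg n)] at h
    rw [Real.sqrt_eq_rpow]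
    norm_num at h ⊢
    nlinarith
  have hs : 0 < √(n : ℝ) := by positivity
  -- This makes the edge term `1/2`, while `√n ≥ 36 L²` gives `(1 + L) ε ≤ 8 L² / √n ≤ 2/9`. With `c
  -- = 1/16` the allowed error `τ` is `1/4`, and `1/4 + 2/9 + 1/2 < 1`.
  set ε : ℝ := 4 * L / √n with hεdef
  have hε : 0 < ε := by positivity
  refine ⟨ε, hε, fun N hN => ?_⟩
  let _ : Fintype N := (hN.finite hε).fintype
  obtain ⟨o, ho, -⟩ := hN.dense (cubeVertex hn fun _ => true)
  classical
  refine ⟨inferInstance, W1 N, inferInstance, inferInstance, inferInstance,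
    ⟨W1.toSpace, fun y => rfl⟩, fun a => W1.molecule a ⟨o, ho⟩,
    W1.lipschitzWith_molecule _, fun F hF => ?_⟩
  by_contra! hcon
  have key := one_le_of_lipschitz_approx hn hε hN ⟨o, ho⟩ hF fun a => (hcon a).le
  have h1 : 1 / 16 * (√n / L) * ε = 1 / 4 := by
    rw [hεdef]; field_simp; norm_num
  have h2 : 2 * L / (ε * √n) = 1 / 2 := by
    rw [hεdef]; field_simp; norm_num
  have h3 : (1 + L) * ε ≤ 2 / 9 := by
    rw [hεdef, ← mul_div_assoc, div_le_iff₀ hs]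
    nlinarith
  rw [h1, h2] at key
  linarith
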